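/- Let $G$ be a finite simple undirected graph with vertex set $V$ and edge set $E$. A graph is called $2$-edge-connected if it is connected and has no bridge; the empty graph and the one-vertex graph count as $2$-edge-connected. For $\emptyset\subsetneq S\subsetneq V$ let $\delta(S)$ be the set of edges with exactly one endpoint in $S$; the sets $\delta(S)$ are the cuts of $G$, and a cut is minimal if no proper subset of it is a cut. Two distinct edges are coparallel if they form a minimal cut of size $2$; a coparallel class of a $2$-edge-connected graph is an inclusion-wise maximal set of edges in which every two distinct edges are coparallel. Let $$\mathrm{TECSP}(G)=\operatorname{conv}\{\chi^{E(H)} : H\subseteq G \text{ is a } 2\text{-edge-connected subgraph}\}\subseteq\mathbb{R}^{E},$$ where $\chi^{F}\in\{0,1\}^E$ is the incidence vector of $F\subseteq E$, and write $x(F)=\sum_{f\in F}x_f$. An inequality $a^{T}x\le b$ defines a facet of a polytope $P$ if it holds for all $x\in P$ and $\dim\{x\in P : a^{T}x=b\}=\dim P-1$. **Theorem.** Let $G$ be $2$-edge-connected and let $\emptyset\subsetneq S\subsetneq V$ be such that $\delta(S)$ is a minimal cut with $|\delta(S)|\ge 3$. Let $e\in\delta(S)$. Then the asymmetric cut inequality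 $$x_e-x(\delta(S)\setminus\{e\})\le 0$$ defines a facet of $\mathrm{TECSP}(G)$ if and only if every bridge of $G[S]$ and every bridge of $G[V\setminus S]$ lies in a coparallel class of $G$ together with an edge of $\delta(S)$. -/

import Mathlib

namespace TwoEdgeConn

variable {V : Type*}

/-- Mathlib's `2`-edge-connectedness says that the graph is connected (or empty) and has no
bridge. -/
theorem isEdgeConnected_two_iff (G : SimpleGraph V) :
    G.IsEdgeConnected 2 ↔ G.Preconnected ∧ ∀ e ∈ G.edgeSet, ¬ G.IsBridge e := by
  constructor
  · intro h
    refine ⟨h.preconnected (by norm_num), ?_⟩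
    rintro ⟨u, v⟩ - hb
    exact hb.not_isEdgeReachable_two (h u v)
  · rintro ⟨h, hb⟩ u v
    obtain ⟨p⟩ := h u v
    induction p with
    | nil => exact .rfl
    | cons hadj _ ih =>
      have h2 := not_not.mp
        (mt (SimpleGraph.isBridge_iff_not_isEdgeReachable_two hadj).mpr (hb _ hadj))
      exact fun s hs => (h2 hs).trans (ih hs)

/-- The cut `δ(S)`: all edges of `G` with exactly one endpoint in `S`. -/
def cut (G : SimpleGraph V) (S : Set V) : Set (Sym2 V) :=
  {e ∈ G.edgeSet | ∃ u ∈ S, ∃ v ∉ S, e = s(u, v)}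

/-- `F` is a cut, i.e. `F = δ(S)` for some `∅ ⊊ S ⊊ V`. -/
def IsCut (G : SimpleGraph V) (F : Set (Sym2 V)) : Prop :=
  ∃ S : Set V, S.Nonempty ∧ S ≠ Set.univ ∧ F = cut G S

/-- `F` is an inclusion-minimal (nonempty) cut. If `G` is connected, every cut is nonempty, and
the nonemptiness requirement is vacuous. -/
def IsMinimalCut (G : SimpleGraph V) (F : Set (Sym2 V)) : Prop :=
  Minimal (fun F' => IsCut G F' ∧ F'.Nonempty) F

/-- Two distinct edges are coparallel if they form a minimal cut of size two. -/
def Coparallel (G : SimpleGraph V) (e f : Sym2 V) : Prop :=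
  e ≠ f ∧ IsMinimalCut G {e, f}

/-- A coparallel class: an inclusion-wise maximal set of edges (bridges are left out)
whose distinct elements are pairwise coparallel. -/
def IsCoparallelClass (G : SimpleGraph V) (C : Set (Sym2 V)) : Prop :=
  C.Nonempty ∧
    Maximal (fun C' : Set (Sym2 V) =>
      C' ⊆ G.edgeSet ∧ (∀ e ∈ C', ¬ G.IsBridge e) ∧ C'.Pairwise (Coparallel G)) C

/-- The incidence vector in `ℝ^{E(G)}` of a set of edges. -/
noncomputable def incidenceVector (G : SimpleGraph V) (F : Set (Sym2 V)) : G.edgeSet → ℝ :=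
  fun e => F.indicator 1 (e : Sym2 V)

/-- The `2`-edge-connected subgraph polytope: the convex hull of the incidence vectors of the
`2`-edge-connected subgraphs. Subgraphs with at most one vertex count as `2`-edge-connected. -/
def TECSP (G : SimpleGraph V) : Set (G.edgeSet → ℝ) :=
  convexHull ℝ {x | ∃ H : G.Subgraph, H.coe.IsEdgeConnected 2 ∧ x = incidenceVector G H.edgeSet}

open Classical in
/-- The linear form `x ↦ x(F) = ∑_{f ∈ F} x_f` on `ℝ^{E(G)}`. -/
noncomputable def edgeSum (G : SimpleGraph V) [Fintype G.edgeSet] (F : Set (Sym2 V)) :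
    (G.edgeSet → ℝ) →ₗ[ℝ] ℝ :=
  ∑ f ∈ Finset.univ.filter (fun f : G.edgeSet => (f : Sym2 V) ∈ F), LinearMap.proj f

/-- The dimension of the affine hull of `P` (for nonempty `P`). -/
noncomputable def affDim {E : Type*} [AddCommGroup E] [Module ℝ E] (P : Set E) : ℕ :=
  Module.finrank ℝ (vectorSpan ℝ P)

/-- The face of `P` cut out by the inequality `a x ≤ b`. -/
def face {E : Type*} [AddCommGroup E] [Module ℝ E] (P : Set E) (a : E →ₗ[ℝ] ℝ) (b : ℝ) : Set E :=
  {x ∈ P | a x = b}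

/-- The inequality `a x ≤ b` defines a facet of `P`: it is valid on `P`, and the face
`P ∩ {a x = b}` is nonempty of dimension `dim P - 1`. -/
def DefinesFacet {E : Type*} [AddCommGroup E] [Module ℝ E]
    (P : Set E) (a : E →ₗ[ℝ] ℝ) (b : ℝ) : Prop :=
  (∀ x ∈ P, a x ≤ b) ∧ (face P a b).Nonempty ∧ affDim (face P a b) + 1 = affDim P

/-- Every bridge of the induced subgraph `G[T]` lies in a coparallel class of `G` together with
an edge of `F`. -/
def BridgesCoparallelTo (G : SimpleGraph V) (T : Set V) (F : Set (Sym2 V)) : Prop :=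
  ∀ u v : T, (G.induce T).Adj u v → (G.induce T).IsBridge s(u, v) →
    ∃ C, IsCoparallelClass G C ∧ s((u : V), (v : V)) ∈ C ∧ ∃ g ∈ F, g ∈ C

end TwoEdgeConn

/-!
Call a subgraph tight if it attains equality, and a vector tight if it lies in the span of the
incidence vectors of tight subgraphs. The polytope and the face both contain `0`, so the inequality
defines a facet if and only if every vector of the hyperplane `x_e = x(δ(S) \ {e})` in the span of
all subgraph vectors is tight. Subgraph vectors are constant on the coparallel classes of `G`.
Deleting a nonbridge `c` from a subgraph `K` turns exactly the coparallel class of `c` in `K` into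
bridges, and the nonbridges of a graph form disjoint `2`-edge-connected subgraphs; hence the
incidence vector of that class lies in the span of the subgraphs of `K`.

If a bridge `b` of `G[S]` is not coparallel to any edge of `δ(S)`, then some cut `δ(A)` consists of
`b` and edges of `δ(S)` other than `e`. A tight subgraph uses at most one of the latter, so every
tight vector satisfies `x_b = x(δ(A) \ {b})`. The incidence vector of the class of `b` does not,
although it vanishes on `δ(S)` and so lies in the hyperplane.

Conversely, subtracting tight vectors makes a vector of the hyperplane vanish on `δ(S)`. What
remains is a combination of classes of edges `c` which are not bridges of `K = G - (δ(S) \ {e})`.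
The class of `c` in `K` is tight. It exceeds the class in `G` by the edges of those cuts of size two
of `K` which some deleted edge `f` crosses. Sorted by the endpoint of `f` on the side of `c`, they
form a laminar family, and each member is the difference of the tight classes of `c` in `K` and in
`K + f`.
-/

namespace TwoEdgeConn

open scoped symmDiff

section Laminar

variable {α : Type*}

/-- A laminar family: any two members are comparable or disjoint. -/
def IsLaminar (𝓕 : Set (Set α)) : Prop :=
  ∀ A ∈ 𝓕, ∀ B ∈ 𝓕, A ⊆ B ∨ B ⊆ A ∨ Disjoint A B

theorem IsLaminar.mono {𝓕 𝓖 : Set (Set α)} (h : IsLaminar 𝓖) (hsub : 𝓕 ⊆ 𝓖) : IsLaminar 𝓕 :=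
  fun A hA B hB => h A (hsub hA) B (hsub hB)

theorem sUnion_induction_of_pairwiseDisjoint {P : Set α → Prop} (h0 : P ∅)
    (hunion : ∀ A B, Disjoint A B → P A → P B → P (A ∪ B)) {𝓕 : Set (Set α)} (hfin : 𝓕.Finite)
    (hdisj : 𝓕.PairwiseDisjoint id) (hP : ∀ A ∈ 𝓕, P A) : P (⋃₀ 𝓕) := by
  induction 𝓕, hfin using Set.Finite.induction_on with
  | empty => rwa [Set.sUnion_empty]
  | @insert A 𝓖 hA _ ih =>
    rw [Set.pairwiseDisjoint_insert_of_notMem hA] at hdisj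
    rw [Set.sUnion_insert]
    exact hunion _ _ (Set.disjoint_sUnion_right.mpr hdisj.2) (hP A (Set.mem_insert A 𝓖))
      (ih hdisj.1 fun B hB => hP B (Set.mem_insert_of_mem A hB))

theorem IsLaminar.sUnion_induction {P : Set α → Prop} (h0 : P ∅)
    (hunion : ∀ A B, Disjoint A B → P A → P B → P (A ∪ B)) {𝓕 : Set (Set α)} (hfin : 𝓕.Finite)
    (hlam : IsLaminar 𝓕) (hP : ∀ A ∈ 𝓕, P A) : P (⋃₀ 𝓕) := by
  set 𝓜 : Set (Set α) := {A | Maximal (· ∈ 𝓕) A}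
  have hsub : 𝓜 ⊆ 𝓕 := fun A hA => hA.prop
  have heq : ⋃₀ 𝓜 = ⋃₀ 𝓕 := by
    refine (Set.sUnion_mono hsub).antisymm (Set.sUnion_subset fun A hA => ?_)
    obtain ⟨B, hAB, hB⟩ := hfin.exists_le_maximal hA
    exact Set.Subset.trans hAB (Set.subset_sUnion_of_mem hB)
  rw [← heq]
  refine sUnion_induction_of_pairwiseDisjoint h0 hunion (hfin.subset hsub) ?_
    fun A hA => hP A (hsub hA)
  intro A hA B hB hAB
  rcases hlam A hA.prop B hB.prop with h | h | h
  · exact absurd (hA.eq_of_le hB.prop h) hAB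
  · exact absurd (hB.eq_of_le hA.prop h).symm hAB
  · exact h

end Laminar

section Polyhedral

variable {𝕜 E : Type*}

theorem vectorSpan_eq_span_of_zero_mem [Ring 𝕜] [AddCommGroup E] [Module 𝕜 E] {X : Set E}
    (h0 : (0 : E) ∈ X) : vectorSpan 𝕜 X = Submodule.span 𝕜 X := by
  simp [vectorSpan_eq_span_vsub_set_right 𝕜 h0]

theorem finrank_inf_ker_add_one [Field 𝕜] [AddCommGroup E] [Module 𝕜 E] [FiniteDimensional 𝕜 E]
    {W : Submodule 𝕜 E} {a : E →ₗ[𝕜] 𝕜} {w : E} (hw : w ∈ W) (haw : a w ≠ 0) :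
    Module.finrank 𝕜 (W ⊓ LinearMap.ker a : Submodule 𝕜 E) + 1 = Module.finrank 𝕜 W := by
  have hne : a.domRestrict W ≠ 0 := fun h => haw (LinearMap.congr_fun h ⟨w, hw⟩)
  rw [← Module.Dual.finrank_ker_add_one_of_ne_zero hne, LinearMap.ker_domRestrict,
    ← (Submodule.comapSubtypeEquivOfLe (inf_le_left : W ⊓ LinearMap.ker a ≤ W)).finrank_eq,
    Submodule.comap_inf, Submodule.comap_subtype_self, top_inf_eq]

variable [AddCommGroup E] [Module ℝ E] {X : Set E} {a : E →ₗ[ℝ] ℝ}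

theorem span_convexHull (X : Set E) :
    Submodule.span ℝ (convexHull ℝ X) = Submodule.span ℝ X :=
  (Submodule.span_le.mpr
    (convexHull_min Submodule.subset_span (Submodule.span ℝ X).convex)).antisymm
    (Submodule.span_mono (subset_convexHull ℝ X))

theorem map_nonpos_of_mem_convexHull (hX : ∀ x ∈ X, a x ≤ 0) :
    ∀ x ∈ convexHull ℝ X, a x ≤ 0 :=
  convexHull_min hX (convex_halfSpace_le a.isLinear 0)

theorem mem_span_of_mem_face_convexHull (hX : ∀ x ∈ X, a x ≤ 0) {x : E}
    (hx : x ∈ face (convexHull ℝ X) a 0) : x ∈ Submodule.span ℝ {x ∈ X | a x = 0} := by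
  set N := Submodule.span ℝ {x ∈ X | a x = 0}
  have hconv : Convex ℝ {x | a x ≤ 0 ∧ (a x = 0 → x ∈ N)} := by
    rintro x ⟨hx, hxN⟩ y ⟨hy, hyN⟩ s t hs ht -
    have hsx : s * a x ≤ 0 := mul_nonpos_of_nonneg_of_nonpos hs hx
    have hty : t * a y ≤ 0 := mul_nonpos_of_nonneg_of_nonpos ht hy
    simp only [Set.mem_ofPred_eq, map_add, map_smul, smul_eq_mul]
    refine ⟨by linarith, fun h => N.add_mem ?_ ?_⟩
    · rcases mul_eq_zero.mp (by linarith : s * a x = 0) with h | h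
      · simp [h]
      · exact N.smul_mem s (hxN h)
    · rcases mul_eq_zero.mp (by linarith : t * a y = 0) with h | h
      · simp [h]
      · exact N.smul_mem t (hyN h)
  have hsub : X ⊆ {x | a x ≤ 0 ∧ (a x = 0 → x ∈ N)} := fun y hy =>
    ⟨hX y hy, fun h => Submodule.subset_span ⟨hy, h⟩⟩
  exact (convexHull_min hsub hconv hx.1).2 hx.2

theorem definesFacet_convexHull_iff [FiniteDimensional ℝ E] (h0 : 0 ∈ X) (hX : ∀ x ∈ X, a x ≤ 0)
    {w : E} (hw : w ∈ Submodule.span ℝ X) (haw : a w ≠ 0) :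
    DefinesFacet (convexHull ℝ X) a 0 ↔
      Submodule.span ℝ X ⊓ LinearMap.ker a ≤ Submodule.span ℝ {x ∈ X | a x = 0} := by
  have h0P : (0 : E) ∈ convexHull ℝ X := subset_convexHull ℝ X h0
  have h0F : (0 : E) ∈ face (convexHull ℝ X) a 0 := ⟨h0P, map_zero a⟩
  have hF : Submodule.span ℝ (face (convexHull ℝ X) a 0) =
      Submodule.span ℝ {x ∈ X | a x = 0} :=
    le_antisymm (Submodule.span_le.mpr fun x hx => mem_span_of_mem_face_convexHull hX hx)
      (Submodule.span_mono fun x hx => ⟨subset_convexHull ℝ X hx.1, hx.2⟩)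
  have hle : Submodule.span ℝ {x ∈ X | a x = 0} ≤ Submodule.span ℝ X ⊓ LinearMap.ker a :=
    le_inf (Submodule.span_mono fun x hx => hx.1) (Submodule.span_le.mpr fun x hx => hx.2)
  rw [DefinesFacet, affDim, affDim, vectorSpan_eq_span_of_zero_mem h0P,
    vectorSpan_eq_span_of_zero_mem h0F, hF, span_convexHull, ← finrank_inf_ker_add_one hw haw]
  refine ⟨fun h => (Submodule.eq_of_le_of_finrank_eq hle ?_).ge, fun h => ?_⟩
  · exact Nat.add_right_cancel h.2.2
  · exact ⟨map_nonpos_of_mem_convexHull hX, ⟨0, h0F⟩, by rw [le_antisymm hle h]⟩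

end Polyhedral

variable {V : Type*} {K G : SimpleGraph V} {A B S : Set V} {b c d e : Sym2 V} {D F : Set (Sym2 V)}

section Cuts

theorem mk_mem_cut {u v : V} : s(u, v) ∈ cut K A ↔ K.Adj u v ∧ (u ∈ A ↔ v ∉ A) := by
  simp only [cut, Set.mem_ofPred_eq, SimpleGraph.mem_edgeSet]
  refine and_congr_right fun _ => ⟨?_, fun h => ?_⟩
  · rintro ⟨x, hx, y, hy, h⟩
    rcases Sym2.eq_iff.mp h with ⟨rfl, rfl⟩ | ⟨rfl, rfl⟩ <;> tauto
  · by_cases hu : u ∈ A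
    · exact ⟨u, hu, v, h.mp hu, rfl⟩
    · exact ⟨v, by tauto, u, hu, Sym2.eq_swap⟩

theorem cut_subset_edgeSet (K : SimpleGraph V) (A : Set V) : cut K A ⊆ K.edgeSet :=
  fun _ h => h.1

theorem cut_symmDiff (K : SimpleGraph V) (A B : Set V) : cut K (A ∆ B) = cut K A ∆ cut K B := by
  ext ⟨u, v⟩
  simp only [Set.mem_symmDiff, mk_mem_cut]
  tauto

@[simp] theorem cut_compl (K : SimpleGraph V) (A : Set V) : cut K Aᶜ = cut K A := by
  ext ⟨u, v⟩
  simp only [Set.mem_compl_iff, mk_mem_cut]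
  tauto

@[simp] theorem cut_empty (K : SimpleGraph V) : cut K ∅ = ∅ := by
  ext d
  simp [cut]

@[simp] theorem cut_univ (K : SimpleGraph V) : cut K Set.univ = ∅ := by
  rw [← Set.compl_empty, cut_compl, cut_empty]

theorem cut_deleteEdges (K : SimpleGraph V) (F : Set (Sym2 V)) (A : Set V) :
    cut (K.deleteEdges F) A = cut K A \ F := by
  ext ⟨u, v⟩
  simp only [Set.mem_sdiff, mk_mem_cut, SimpleGraph.deleteEdges_adj]
  tauto

theorem cut_eq_inter_edgeSet (h : K ≤ G) (A : Set V) : cut K A = cut G A ∩ K.edgeSet := by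
  ext ⟨u, v⟩
  simp only [Set.mem_inter_iff, mk_mem_cut, SimpleGraph.mem_edgeSet]
  have := @h u v
  tauto

theorem cut_inter_subset (K : SimpleGraph V) (A B : Set V) :
    cut K (A ∩ B) ⊆ cut K A ∪ cut K B := by
  rintro ⟨u, v⟩
  simp only [Set.mem_union, Set.mem_inter_iff, mk_mem_cut]
  tauto

theorem image_cut_coe (H : G.Subgraph) (A : Set V) :
    Sym2.map Subtype.val '' cut H.coe (Subtype.val ⁻¹' A) = cut G A ∩ H.edgeSet := by
  ext d
  constructor
  · rintro ⟨⟨x, y⟩, hxy, rfl⟩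
    rw [mk_mem_cut] at hxy
    exact ⟨mk_mem_cut.mpr ⟨H.adj_sub hxy.1, hxy.2⟩, hxy.1⟩
  · induction d with | h x y =>
    rintro ⟨hxy, hH⟩
    have hadj : H.Adj x y := hH
    exact ⟨s(⟨x, hadj.fst_mem⟩, ⟨y, hadj.snd_mem⟩),
      mk_mem_cut.mpr ⟨hadj, (mk_mem_cut.mp hxy).2⟩, rfl⟩

end Cuts

section Connectivity

theorem reachable_iff_forall_cut {u v : V} :
    K.Reachable u v ↔ ∀ A, cut K A = ∅ → u ∈ A → v ∈ A := by
  constructor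
  · rintro ⟨p⟩ A hA hu
    induction p with
    | nil => exact hu
    | @cons x y z hadj _ ih =>
      refine ih ?_
      by_contra hy
      have : s(x, y) ∈ cut K A := mk_mem_cut.mpr ⟨hadj, by tauto⟩
      simp [hA] at this
  · refine fun h => h {w | K.Reachable u w} ?_ (SimpleGraph.Reachable.refl u)
    rw [Set.eq_empty_iff_forall_notMem]
    rintro ⟨x, y⟩ hxy
    obtain ⟨hadj, hxy⟩ := mk_mem_cut.mp hxy
    have h1 : K.Reachable u x → K.Reachable u y := fun hx => hx.trans hadj.reachable
    have h2 : K.Reachable u y → K.Reachable u x := fun hx => hx.trans hadj.symm.reachable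
    simp only [Set.mem_ofPred_eq] at hxy
    tauto

theorem preconnected_iff_forall_cut :
    K.Preconnected ↔ ∀ A, cut K A = ∅ → A = ∅ ∨ A = Set.univ := by
  simp only [SimpleGraph.Preconnected, reachable_iff_forall_cut]
  constructor
  · intro h A hA
    refine A.eq_empty_or_nonempty.imp_right fun ⟨u, hu⟩ => ?_
    exact Set.eq_univ_of_forall fun v => h u v A hA hu
  · rintro h u v A hA hu
    rcases h A hA with rfl | rfl
    · exact absurd hu (Set.notMem_empty u)
    · exact Set.mem_univ v

theorem cut_nonempty (hK : K.Preconnected) (hA : A.Nonempty) {q : V} (hq : q ∉ A) :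
    (cut K A).Nonempty := by
  rw [Set.nonempty_iff_ne_empty]
  intro h
  rcases preconnected_iff_forall_cut.mp hK A h with rfl | rfl
  · exact Set.not_nonempty_empty hA
  · exact hq (Set.mem_univ q)

theorem isBridge_iff_exists_cut (hd : d ∈ K.edgeSet) :
    K.IsBridge d ↔ ∃ A, cut K A = {d} := by
  induction d with | h u v =>
  rw [SimpleGraph.isBridge_iff, reachable_iff_forall_cut]
  push Not
  simp only [cut_deleteEdges, Set.sdiff_eq_empty]
  constructor
  · rintro ⟨A, hA, hu, hv⟩
    exact ⟨A, hA.antisymm (Set.singleton_subset_iff.mpr (mk_mem_cut.mpr ⟨hd, by tauto⟩))⟩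
  · rintro ⟨A, hA⟩
    have huv : s(u, v) ∈ cut K A := by simp [hA]
    rw [mk_mem_cut] at huv
    by_cases hu : u ∈ A
    · exact ⟨A, hA.le, hu, huv.2.mp hu⟩
    · exact ⟨Aᶜ, (cut_compl K A).trans_subset hA.le, hu, by simp only [Set.mem_compl_iff]; tauto⟩

theorem cut_ne_singleton (hG : G.IsEdgeConnected 2) (A : Set V) (d : Sym2 V) : cut G A ≠ {d} := by
  intro h
  have hd : d ∈ G.edgeSet := cut_subset_edgeSet G A (by simp [h])
  exact ((isEdgeConnected_two_iff G).mp hG).2 d hd ((isBridge_iff_exists_cut hd).mpr ⟨A, h⟩)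

theorem eq_of_cut_eq (hK : K.Preconnected) (h : cut K A = cut K B) {q : V} (hA : q ∉ A)
    (hB : q ∉ B) : A = B := by
  rcases preconnected_iff_forall_cut.mp hK (A ∆ B) (by rw [cut_symmDiff, h, symmDiff_self]; rfl)
    with hAB | hAB
  · exact symmDiff_eq_bot.mp hAB
  · have hq : q ∈ A ∆ B := hAB ▸ Set.mem_univ q
    rw [Set.mem_symmDiff] at hq
    tauto

theorem isBridge_coe_iff_exists_cut {H : G.Subgraph} {d : Sym2 H.verts}
    (hd : d ∈ H.coe.edgeSet) :
    H.coe.IsBridge d ↔ ∃ A, cut G A ∩ H.edgeSet = {d.map Subtype.val} := by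
  have hinj := (Sym2.map.injective (Subtype.val_injective (p := (· ∈ H.verts)))).image_injective
  rw [isBridge_iff_exists_cut hd]
  constructor
  · rintro ⟨A, hA⟩
    refine ⟨Subtype.val '' A, ?_⟩
    rw [← image_cut_coe, Set.preimage_image_eq A Subtype.val_injective, hA, Set.image_singleton]
  · rintro ⟨A, hA⟩
    exact ⟨Subtype.val ⁻¹' A, hinj (by rw [image_cut_coe, hA, Set.image_singleton])⟩

theorem cut_inter_edgeSet_ne_singleton {H : G.Subgraph} (hH : H.coe.IsEdgeConnected 2)
    (A : Set V) (d : Sym2 V) : cut G A ∩ H.edgeSet ≠ {d} := by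
  intro h
  have hd : d ∈ H.edgeSet := (h.ge rfl).2
  induction d with | h u v =>
  have hadj : H.Adj u v := hd
  have hedge : s(⟨u, hadj.fst_mem⟩, ⟨v, hadj.snd_mem⟩) ∈ H.coe.edgeSet := hadj
  exact ((isEdgeConnected_two_iff _).mp hH).2 _ hedge
    ((isBridge_coe_iff_exists_cut hedge).mpr ⟨A, h⟩)

theorem isBridge_induce_iff_exists_cut {T : Set V} {u v : T} (huv : (G.induce T).Adj u v) :
    (G.induce T).IsBridge s(u, v) ↔ ∃ A, cut G A \ cut G T = {s((u : V), (v : V))} := by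
  have hadj : G.Adj u v := huv
  have hcut : ∀ A, cut G A ∩ ((⊤ : G.Subgraph).induce T).edgeSet = cut G (A ∩ T) \ cut G T := by
    intro A
    ext ⟨x, y⟩
    simp only [Set.mem_inter_iff, Set.mem_sdiff, mk_mem_cut, SimpleGraph.Subgraph.mem_edgeSet,
      SimpleGraph.Subgraph.induce_adj, SimpleGraph.Subgraph.top_adj]
    tauto
  rw [SimpleGraph.induce_eq_coe_induce_top] at huv ⊢
  refine (isBridge_coe_iff_exists_cut (H := (⊤ : G.Subgraph).induce T) huv).trans ?_
  simp only [hcut]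
  refine ⟨fun ⟨A, hA⟩ => ⟨A ∩ T, hA⟩, fun ⟨A, hA⟩ => ⟨A, ?_⟩⟩
  have huvA : s((u : V), (v : V)) ∈ cut G A := (hA.ge rfl).1
  rw [mk_mem_cut] at huvA
  refine Set.Subset.antisymm (fun d hd => hA.le ?_) (Set.singleton_subset_iff.mpr ?_)
  · exact ⟨(cut_inter_subset G A T hd.1).resolve_right hd.2, hd.2⟩
  · exact ⟨mk_mem_cut.mpr ⟨hadj, by simpa using huvA.2⟩, (hA.ge rfl).2⟩

end Connectivity

section MinimalCuts

theorem isCut_cut (h : (cut G A).Nonempty) : IsCut G (cut G A) := by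
  refine ⟨A, Set.nonempty_iff_ne_empty.mpr ?_, ?_, rfl⟩ <;> rintro rfl <;> simp at h

theorem IsMinimalCut.eq_of_cut_subset (hD : IsMinimalCut G D) (hA : (cut G A).Nonempty)
    (h : cut G A ⊆ D) : cut G A = D :=
  h.antisymm (hD.le_of_le ⟨isCut_cut hA, hA⟩ h)

theorem IsMinimalCut.preconnected_deleteEdges (hD : IsMinimalCut G D) (hG : G.Preconnected)
    (hF : F ⊂ D) : (G.deleteEdges F).Preconnected := by
  refine preconnected_iff_forall_cut.mpr fun A hA => preconnected_iff_forall_cut.mp hG A ?_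
  rw [cut_deleteEdges, Set.sdiff_eq_empty] at hA
  by_contra hne
  have hAD := hD.eq_of_cut_subset (Set.nonempty_iff_ne_empty.mpr hne) (hA.trans hF.subset)
  exact hF.not_subset (hAD ▸ hA)

theorem coparallel_iff_exists_cut (hG : G.IsEdgeConnected 2) :
    Coparallel G c d ↔ c ≠ d ∧ ∃ A, cut G A = {c, d} := by
  refine and_congr_right fun _ => ⟨fun ⟨⟨⟨A, _, _, h⟩, _⟩, _⟩ => ⟨A, h.symm⟩, ?_⟩
  rintro ⟨A, hA⟩
  have hne : (cut G A).Nonempty := by simp [hA]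
  refine ⟨⟨hA ▸ isCut_cut hne, by simp⟩, ?_⟩
  rintro F ⟨⟨B, -, -, rfl⟩, hF⟩ hsub
  rcases Set.subset_pair_iff_eq.mp hsub with h | h | h | h
  · simp [h] at hF
  · exact absurd h (cut_ne_singleton hG _ _)
  · exact absurd h (cut_ne_singleton hG _ _)
  · exact h.ge

end MinimalCuts

section CoparallelClasses

/-- The edges of `K` that are not bridges. -/
def nonbridges (K : SimpleGraph V) : Set (Sym2 V) :=
  {d ∈ K.edgeSet | ¬ K.IsBridge d}

theorem mem_nonbridges_iff : d ∈ nonbridges K ↔ d ∈ K.edgeSet ∧ ∀ A, cut K A ≠ {d} :=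
  and_congr_right fun hd => by rw [isBridge_iff_exists_cut hd, not_exists]

theorem nonbridges_mono (h : K ≤ G) : nonbridges K ⊆ nonbridges G := fun _ hd =>
  ⟨SimpleGraph.edgeSet_subset_edgeSet.mpr h hd.1, fun hbr => hd.2 (hbr.anti h)⟩

theorem nonbridges_eq_edgeSet (hG : G.IsEdgeConnected 2) : nonbridges G = G.edgeSet :=
  Set.sep_eq_self_iff_mem_true.mpr ((isEdgeConnected_two_iff G).mp hG).2

theorem eq_empty_of_cut_subset_singleton (hK : K.Preconnected) (hd : d ∈ nonbridges K)
    (hA : cut K A ⊆ {d}) : A = ∅ ∨ A = Set.univ :=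
  preconnected_iff_forall_cut.mp hK A <|
    (Set.subset_singleton_iff_eq.mp hA).resolve_right ((mem_nonbridges_iff.mp hd).2 A)

theorem cut_inter_nonbridges_ne_singleton (K : SimpleGraph V) (A : Set V) (d : Sym2 V) :
    cut K A ∩ nonbridges K ≠ {d} := by
  intro h
  set L := K.deleteEdges {c | K.IsBridge c}
  have hLK : L.edgeSet = nonbridges K := SimpleGraph.edgeSet_deleteEdges _
  obtain ⟨-, hdK, hd⟩ := h.ge rfl
  have hbr : L.IsBridge d := (isBridge_iff_exists_cut (hLK.ge ⟨hdK, hd⟩)).mpr ⟨A, by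
    rw [cut_eq_inter_edgeSet (SimpleGraph.deleteEdges_le _), hLK, h]⟩
  -- A cycle through a nonbridge contains no bridge, so it survives in `L`.
  rw [SimpleGraph.isBridge_iff_forall_cycle_notMem hdK] at hd
  push Not at hd
  obtain ⟨u, p, hp, hdp⟩ := hd
  have hpL : ∀ c ∈ p.edges, c ∈ L.edgeSet := fun c hc =>
    hLK.ge ⟨p.edges_subset_edgeSet hc, fun hbr => hbr.notMem_edges_of_isCycle hp hc⟩
  exact hbr.notMem_edges_of_isCycle (hp.transfer hpL) (by rwa [SimpleGraph.Walk.edges_transfer])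

/-- The coparallel class of an edge `c`: the edge `c` itself (take `A = ∅`) and all edges that form
a cut of size two together with `c`. -/
def coparClass (K : SimpleGraph V) (c : Sym2 V) : Set (Sym2 V) :=
  {d | ∃ A, cut K A = {c} ∆ {d}}

theorem mem_coparClass_self (K : SimpleGraph V) (c : Sym2 V) : c ∈ coparClass K c :=
  ⟨∅, by simp⟩

theorem mem_coparClass_symm (h : d ∈ coparClass K c) : c ∈ coparClass K d := by
  obtain ⟨A, hA⟩ := h
  exact ⟨A, hA.trans (symmDiff_comm _ _)⟩

theorem mem_coparClass_trans (hc : c ∈ coparClass K b) (hd : d ∈ coparClass K c) :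
    d ∈ coparClass K b := by
  obtain ⟨A, hA⟩ := hc
  obtain ⟨B, hB⟩ := hd
  exact ⟨A ∆ B, by rw [cut_symmDiff, hA, hB, symmDiff_assoc, symmDiff_symmDiff_cancel_left]⟩

theorem singleton_symmDiff_singleton {α : Type*} {a b : α} (h : a ≠ b) :
    ({a} : Set α) ∆ {b} = {a, b} := by
  ext x
  simp only [Set.mem_symmDiff, Set.mem_insert_iff, Set.mem_singleton_iff]
  grind

theorem mem_coparClass_iff (h : c ≠ d) : d ∈ coparClass K c ↔ ∃ A, cut K A = {c, d} := by
  rw [coparClass, Set.mem_ofPred_eq, singleton_symmDiff_singleton h]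

theorem coparClass_subset_nonbridges (hc : c ∈ nonbridges K) :
    coparClass K c ⊆ nonbridges K := by
  intro d hd
  rcases eq_or_ne c d with rfl | hcd
  · exact hc
  obtain ⟨A, hA⟩ := id hd
  refine mem_nonbridges_iff.mpr ⟨?_, fun B hB => (mem_nonbridges_iff.mp hc).2 (A ∆ B) ?_⟩
  · exact cut_subset_edgeSet K A (by simp [hA, singleton_symmDiff_singleton hcd])
  · rw [cut_symmDiff, hA, hB, symmDiff_symmDiff_cancel_right]

theorem nonbridges_deleteEdges_singleton (K : SimpleGraph V) (c : Sym2 V) :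
    nonbridges (K.deleteEdges {c}) = nonbridges K \ coparClass K c := by
  ext d
  rcases eq_or_ne c d with rfl | hcd
  · simp [nonbridges, mem_coparClass_self]
  have hsdiff : ∀ A, cut K A \ {c} = {d} ↔ cut K A = {d} ∨ cut K A = {c, d} := by
    intro A
    by_cases hc : c ∈ cut K A
    · have hne : cut K A ≠ {d} := fun h => hcd (h.le hc)
      rw [or_iff_right hne]
      exact ⟨fun h => by rw [← Set.insert_sdiff_self_of_mem hc, h],
        fun h => by rw [h, Set.pair_sdiff_left hcd]⟩
    · have hne : cut K A ≠ {c, d} := fun h => hc (by simp [h])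
      rw [or_iff_left hne, Set.sdiff_singleton_eq_self hc]
  simp only [Set.mem_sdiff, ne_eq, mem_nonbridges_iff, cut_deleteEdges, hsdiff,
    mem_coparClass_iff hcd, SimpleGraph.edgeSet_deleteEdges, Set.mem_singleton_iff]
  grind

theorem coparClass_anti (h : K ≤ G) (hc : c ∈ nonbridges K) :
    coparClass G c ⊆ coparClass K c := by
  rintro d ⟨A, hA⟩
  rcases eq_or_ne c d with rfl | hcd
  · exact mem_coparClass_self K c
  rw [singleton_symmDiff_singleton hcd] at hA
  have hcut := cut_eq_inter_edgeSet h A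
  rw [hA] at hcut
  by_cases hd : d ∈ K.edgeSet
  · refine (mem_coparClass_iff hcd).mpr ⟨A, hcut.trans (Set.inter_eq_left.mpr ?_)⟩
    exact Set.pair_subset hc.1 hd
  · refine absurd (hcut.trans ?_) ((mem_nonbridges_iff.mp hc).2 A)
    rw [Set.insert_inter_of_mem hc.1, Set.singleton_inter_eq_empty.mpr hd]
    exact insert_empty_eq c

theorem exists_isCoparallelClass_iff (hG : G.IsEdgeConnected 2) (hc : c ∈ G.edgeSet) :
    (∃ C, IsCoparallelClass G C ∧ c ∈ C ∧ d ∈ C) ↔ d ∈ coparClass G c := by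
  have hcopar : ∀ {x y}, x ≠ y → (Coparallel G x y ↔ y ∈ coparClass G x) := fun hxy => by
    rw [coparallel_iff_exists_cut hG, mem_coparClass_iff hxy, and_iff_right hxy]
  have hmem : ∀ C, C.Pairwise (Coparallel G) → c ∈ C → C ⊆ coparClass G c := by
    intro C hC hcC x hx
    rcases eq_or_ne c x with rfl | hcx
    · exact mem_coparClass_self G c
    · exact (hcopar hcx).mp (hC hcC hx hcx)
  have hsub := coparClass_subset_nonbridges ((nonbridges_eq_edgeSet hG).ge hc)
  constructor
  · rintro ⟨C, ⟨-, ⟨-, -, hC⟩, -⟩, hcC, hdC⟩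
    exact hmem C hC hcC hdC
  · refine fun hd => ⟨coparClass G c, ⟨⟨c, mem_coparClass_self G c⟩, ⟨?_, ?_, ?_⟩, ?_⟩,
      mem_coparClass_self G c, hd⟩
    · exact fun x hx => (hsub hx).1
    · exact fun x hx => (hsub hx).2
    · exact fun x hx y hy hxy =>
        (hcopar hxy).mpr (mem_coparClass_trans (mem_coparClass_symm hx) hy)
    · exact fun C ⟨_, _, hC⟩ hle => hmem C hC (hle (mem_coparClass_self G c))

theorem BridgesCoparallelTo.exists_mem_cut_mem_coparClass (hG : G.IsEdgeConnected 2)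
    (hbr : BridgesCoparallelTo G S (cut G S)) (e : Sym2 V) (hc : c ∈ G.edgeSet)
    (hcS : ∀ x ∈ c, x ∈ S) (hcK : c ∉ nonbridges (G.deleteEdges (cut G S \ {e}))) :
    ∃ g ∈ cut G S, g ∈ coparClass G c := by
  induction c with | h u v =>
  have hu : u ∈ S := hcS u (Sym2.mem_mk_left u v)
  have hv : v ∈ S := hcS v (Sym2.mem_mk_right u v)
  have hcD : s(u, v) ∉ cut G S := by
    rw [mk_mem_cut]
    tauto
  have hcE : s(u, v) ∈ (G.deleteEdges (cut G S \ {e})).edgeSet := by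
    rw [SimpleGraph.edgeSet_deleteEdges]
    exact ⟨hc, fun h => hcD h.1⟩
  obtain ⟨A, hA⟩ : ∃ A, cut G A \ (cut G S \ {e}) = {s(u, v)} := by
    by_contra! h
    exact hcK (mem_nonbridges_iff.mpr ⟨hcE, by simpa only [cut_deleteEdges] using h⟩)
  have hb : (G.induce S).IsBridge s(⟨u, hu⟩, ⟨v, hv⟩) :=
    (isBridge_induce_iff_exists_cut (u := ⟨u, hu⟩) (v := ⟨v, hv⟩) hc).mpr ⟨A, by grind⟩
  obtain ⟨C, hC, hcC, g, hg, hgC⟩ := hbr ⟨u, hu⟩ ⟨v, hv⟩ hc hb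
  exact ⟨g, hg, (exists_isCoparallelClass_iff hG hc).mp ⟨C, hC, hcC, hgC⟩⟩

theorem IsMinimalCut.inter_nonbridges_deleteEdges (hD : IsMinimalCut G D) {f : Sym2 V}
    (he : e ∈ D) (hf : f ∈ D) (hef : e ≠ f) :
    D ∩ nonbridges (G.deleteEdges (D \ {e, f})) = {e, f} := by
  have hmem : ∀ {x y}, x ∈ D → y ∈ D → x ≠ y → x ∈ nonbridges (G.deleteEdges (D \ {x, y})) := by
    intro x y hx hy hxy
    obtain ⟨⟨S, -, -, rfl⟩, -⟩ := hD.prop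
    refine mem_nonbridges_iff.mpr ⟨by simp [hx.1], fun A hA => hxy ?_⟩
    rw [cut_deleteEdges] at hA
    have hxA : x ∈ cut G A := (hA.ge rfl).1
    have hAD : cut G A ⊆ cut G S := fun z hz => by
      by_contra hzD
      exact hzD ((hA.le ⟨hz, fun h => hzD h.1⟩ : z = x) ▸ hx)
    have hyA : y ∈ cut G A := (hD.eq_of_cut_subset ⟨x, hxA⟩ hAD).ge hy
    exact (hA.le ⟨hyA, by simp⟩ : y = x).symm
  refine Set.Subset.antisymm (fun x ⟨hxD, hx⟩ => ?_) (Set.pair_subset ⟨he, hmem he hf hef⟩ ⟨hf, ?_⟩)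
  · have hxE : x ∈ (G.deleteEdges (D \ {e, f})).edgeSet := hx.1
    rw [SimpleGraph.edgeSet_deleteEdges] at hxE
    exact by_contra fun h => hxE.2 ⟨hxD, h⟩
  · rw [Set.pair_comm]
    exact hmem hf he hef.symm

end CoparallelClasses

section SeparatedEdges

theorem subset_or_subset_or_disjoint_of_cut_subset (hK : K.Preconnected) {d' : Sym2 V}
    (hA : cut K A ⊆ {d}) (hB : cut K B ⊆ {d'}) {q : V} (hqA : q ∉ A) (hqB : q ∉ B) :
    A ⊆ B ∨ B ⊆ A ∨ Disjoint A B := by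
  by_contra! h
  obtain ⟨hAB, hBA, hdisj⟩ := h
  have hcross : ∀ X : Set V, X.Nonempty → q ∉ X → cut K X ⊆ cut K A ∪ cut K B →
      d ∈ cut K X ∨ d' ∈ cut K X := by
    intro X hX hqX hsub
    obtain ⟨g, hg⟩ := cut_nonempty hK hX hqX
    rcases hsub hg with h | h
    · exact Or.inl (hA h ▸ hg)
    · exact Or.inr (hB h ▸ hg)
  have hinter := hcross (A ∩ B) (Set.not_disjoint_iff_nonempty_inter.mp hdisj) (by simp [hqA])
    (cut_inter_subset K A B)
  have hsdiff := hcross (A ∩ Bᶜ) (by rwa [← Set.sdiff_eq, Set.sdiff_nonempty]) (by simp [hqA])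
    (by simpa using cut_inter_subset K A Bᶜ)
  have hsdiff' := hcross (B ∩ Aᶜ) (by rwa [← Set.sdiff_eq, Set.sdiff_nonempty]) (by simp [hqB])
    (by simpa [Set.union_comm] using cut_inter_subset K B Aᶜ)
  have hunion := hcross (A ∪ B) ((Set.not_disjoint_iff_nonempty_inter.mp hdisj).mono <|
    Set.inter_subset_left.trans Set.subset_union_left) (by simp [hqA, hqB])
    (by simpa [← Set.compl_union] using cut_inter_subset K Aᶜ Bᶜ)
  -- An edge crossing only one of `A` and `B` leaves the boundary of two of the four regions empty,
  -- and two such edges always leave out a common region.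
  have hdA : d' ∈ cut K A → d' = d := fun h => hA h
  have hdB : d ∈ cut K B → d = d' := fun h => hB h
  induction d with | h x y =>
  induction d' with | h z w =>
  simp only [mk_mem_cut, Set.mem_inter_iff, Set.mem_union, Set.mem_compl_iff, Sym2.eq_iff] at *
  grind

theorem subset_or_subset_or_disjoint_of_cut_eq_pair (hK : K.Preconnected)
    (hc : c ∈ nonbridges K) {d' : Sym2 V} (hA : cut K A = {c, d}) (hB : cut K B = {c, d'}) {q : V}
    (hqA : q ∉ A) (hqB : q ∉ B) : A ⊆ B ∨ B ⊆ A ∨ Disjoint A B := by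
  have hL : (K.deleteEdges {c}).Preconnected := by
    refine preconnected_iff_forall_cut.mpr fun A hA => eq_empty_of_cut_subset_singleton hK hc ?_
    rwa [cut_deleteEdges, Set.sdiff_eq_empty] at hA
  refine subset_or_subset_or_disjoint_of_cut_subset hL (d := d) (d' := d') ?_ ?_ hqA hqB <;>
    simp [cut_deleteEdges, hA, hB]

theorem not_disjoint_of_mem_cut {A₁ A₂ : Set V} (h₁ : A₁ ⊆ A) (h₂ : A₂ ⊆ A) (hcA : c ∈ cut K A)
    (hc₁ : c ∈ cut K A₁) (hc₂ : c ∈ cut K A₂) : ¬ Disjoint A₁ A₂ := by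
  obtain ⟨-, u, _, v, hv, rfl⟩ := hcA
  rw [mk_mem_cut] at hc₁ hc₂
  have hv₁ : v ∉ A₁ := fun h => hv (h₁ h)
  have hv₂ : v ∉ A₂ := fun h => hv (h₂ h)
  exact Set.not_disjoint_iff.mpr ⟨u, hc₁.2.mpr hv₁, hc₂.2.mpr hv₂⟩

/-- The edges that form a cut of size two together with `c` which separates `w` from the base
vertex `q`. Fixing `q` singles out one side of every such cut. -/
def separatedEdges (K : SimpleGraph V) (q : V) (c : Sym2 V) (w : V) : Set (Sym2 V) :=
  {d | ∃ A, cut K A = {c, d} ∧ q ∉ A ∧ w ∈ A}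

theorem isLaminar_range_separatedEdges (hK : K.Preconnected) (hc : c ∈ nonbridges K) (q : V) :
    IsLaminar (Set.range (separatedEdges K q c)) := by
  rintro _ ⟨w₁, rfl⟩ _ ⟨w₂, rfl⟩
  by_contra! h
  obtain ⟨h₁, h₂, h⟩ := h
  obtain ⟨d₁, ⟨A₁, hA₁, hqA₁, hwA₁⟩, hd₁⟩ := Set.not_subset.mp h₁
  obtain ⟨d₂, ⟨A₂, hA₂, hqA₂, hwA₂⟩, hd₂⟩ := Set.not_subset.mp h₂
  obtain ⟨d, ⟨A, hA, hqA, hwA⟩, ⟨B, hB, hqB, hwB⟩⟩ := Set.not_disjoint_iff.mp h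
  obtain rfl : A = B := eq_of_cut_eq hK (hA.trans hB.symm) hqA hqB
  have hw₂ : w₂ ∉ A₁ := fun hw => hd₁ ⟨A₁, hA₁, hqA₁, hw⟩
  have hw₁ : w₁ ∉ A₂ := fun hw => hd₂ ⟨A₂, hA₂, hqA₂, hw⟩
  have hAA₁ : A₁ ⊆ A := by
    rcases subset_or_subset_or_disjoint_of_cut_eq_pair hK hc hA₁ hA hqA₁ hqA with h | h | h
    · exact h
    · exact absurd (h hwB) hw₂
    · exact absurd hwA (Set.disjoint_left.mp h hwA₁)
  have hAA₂ : A₂ ⊆ A := by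
    rcases subset_or_subset_or_disjoint_of_cut_eq_pair hK hc hA₂ hA hqA₂ hqA with h | h | h
    · exact h
    · exact absurd (h hwA) hw₁
    · exact absurd hwB (Set.disjoint_left.mp h hwA₂)
  rcases subset_or_subset_or_disjoint_of_cut_eq_pair hK hc hA₁ hA₂ hqA₁ hqA₂ with h | h | h
  · exact hw₁ (h hwA₁)
  · exact hw₂ (h hwA₂)
  · exact not_disjoint_of_mem_cut (c := c) hAA₁ hAA₂ (hA ▸ Set.mem_insert c _)
      (hA₁ ▸ Set.mem_insert c _) (hA₂ ▸ Set.mem_insert c _) h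

theorem subset_of_cut_eq_pair (hK : K.Preconnected) (hc : c ∈ nonbridges K) (hcS : ∀ x ∈ c, x ∈ S)
    {p q : V} (hS : cut K S = {s(p, q)}) (hp : p ∈ S) (hq : q ∉ A) (hA : cut K A = {c, d}) :
    A ⊆ S := by
  have hd : d ∈ nonbridges K := by
    rcases eq_or_ne c d with rfl | hcd
    · exact hc
    · exact coparClass_subset_nonbridges hc ((mem_coparClass_iff hcd).mpr ⟨A, hA⟩)
  have hcut : cut K (A ∩ Sᶜ) ⊆ {d} := by
    intro g hg
    obtain ⟨-, u, hu, v, _, rfl⟩ := id hg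
    have hsub := cut_inter_subset K A Sᶜ hg
    rw [cut_compl, hA, hS] at hsub
    rcases hsub with (h | h) | h
    · exact absurd (hcS u (h ▸ Sym2.mem_mk_left u v)) hu.2
    · exact h
    · rcases Sym2.eq_iff.mp h with ⟨rfl, rfl⟩ | ⟨rfl, rfl⟩
      · exact absurd hp hu.2
      · exact absurd hu.1 hq
  rw [← Set.sdiff_eq_empty, Set.sdiff_eq]
  exact (eq_empty_of_cut_subset_singleton hK hd hcut).resolve_right fun h =>
    hq (h.ge (Set.mem_univ q)).1

theorem exists_cut_eq_notMem (hA : cut K A = {c, d}) (q : V) : ∃ B, cut K B = {c, d} ∧ q ∉ B := by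
  by_cases hq : q ∈ A
  · exact ⟨Aᶜ, (cut_compl K A).trans hA, not_not.mpr hq⟩
  · exact ⟨A, hA, hq⟩

theorem coparClass_sdiff_coparClass_eq_biUnion {p q : V} (hKG : K ≤ G) (hK : K.Preconnected)
    (hc : c ∈ nonbridges K) (hcS : ∀ x ∈ c, x ∈ S) (hS : cut K S = {s(p, q)}) (hp : p ∈ S)
    (hGS : G.edgeSet \ K.edgeSet ⊆ cut G S) :
    coparClass K c \ coparClass G c =
      ⋃ w ∈ {w ∈ S | ∃ z ∉ S, s(w, z) ∈ G.edgeSet \ K.edgeSet}, separatedEdges K q c w := by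
  ext d
  simp only [Set.mem_sdiff, Set.mem_iUnion₂]
  constructor
  · rintro ⟨hdK, hdG⟩
    have hcd : c ≠ d := by
      rintro rfl
      exact hdG (mem_coparClass_self G c)
    obtain ⟨A', hA'⟩ := (mem_coparClass_iff hcd).mp hdK
    obtain ⟨A, hA, hqA⟩ := exists_cut_eq_notMem hA' q
    have hAS := subset_of_cut_eq_pair hK hc hcS hS hp hqA hA
    obtain ⟨g, hgA, hgK⟩ : ∃ g ∈ cut G A, g ∉ K.edgeSet := by
      by_contra! h
      refine hdG ((mem_coparClass_iff hcd).mpr ⟨A, ?_⟩)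
      rw [← hA, cut_eq_inter_edgeSet hKG, Set.inter_eq_left.mpr h]
    obtain ⟨-, w, hw, z, hz, rfl⟩ := hGS ⟨cut_subset_edgeSet G A hgA, hgK⟩
    rw [mk_mem_cut] at hgA
    exact ⟨w, ⟨hw, z, hz, hgA.1, hgK⟩, A, hA, hqA, hgA.2.mpr fun h => hz (hAS h)⟩
  · rintro ⟨w, ⟨-, z, hz, hwzG, hwzK⟩, A, hA, hqA, hwA⟩
    have hAS := subset_of_cut_eq_pair hK hc hcS hS hp hqA hA
    have hcd : c ≠ d := by
      rintro rfl
      exact (mem_nonbridges_iff.mp hc).2 A (by simpa using hA)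
    refine ⟨(mem_coparClass_iff hcd).mpr ⟨A, hA⟩, fun hdG => hwzK ?_⟩
    obtain ⟨B', hB'⟩ := (mem_coparClass_iff hcd).mp hdG
    obtain ⟨B, hB, hqB⟩ := exists_cut_eq_notMem hB' q
    have hcdK : {c, d} ⊆ K.edgeSet := hA ▸ cut_subset_edgeSet K A
    obtain rfl : A = B := eq_of_cut_eq hK
      (by rw [hA, cut_eq_inter_edgeSet hKG, hB, Set.inter_eq_left.mpr hcdK]) hqA hqB
    exact hcdK (hB ▸ mk_mem_cut.mpr ⟨hwzG, iff_of_true hwA fun h => hz (hAS h)⟩)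

end SeparatedEdges

section SubgraphVectors

/-- The incidence vectors of the `2`-edge-connected subgraphs of `G` that use only edges of `K`. -/
def subgraphVectors (G K : SimpleGraph V) : Set (G.edgeSet → ℝ) :=
  {x | ∃ H : G.Subgraph, H.coe.IsEdgeConnected 2 ∧ H.edgeSet ⊆ K.edgeSet ∧
    x = incidenceVector G H.edgeSet}

theorem TECSP_eq_convexHull (G : SimpleGraph V) :
    TECSP G = convexHull ℝ (subgraphVectors G G) := by
  simp only [TECSP, subgraphVectors, SimpleGraph.Subgraph.edgeSet_subset, true_and]

theorem zero_mem_subgraphVectors (G K : SimpleGraph V) : 0 ∈ subgraphVectors G K :=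
  ⟨⊥, fun u => (Set.notMem_empty _ u.2).elim, by simp, by ext; simp [incidenceVector]⟩

theorem subgraphVectors_mono {K L : SimpleGraph V} (G : SimpleGraph V) (h : K ≤ L) :
    subgraphVectors G K ⊆ subgraphVectors G L := fun _ ⟨H, hH, hHK, hx⟩ =>
  ⟨H, hH, hHK.trans (SimpleGraph.edgeSet_subset_edgeSet.mpr h), hx⟩

theorem incidenceVector_of_mem {d : G.edgeSet} (h : (d : Sym2 V) ∈ F) :
    incidenceVector G F d = 1 := Set.indicator_of_mem h 1

theorem incidenceVector_of_notMem {d : G.edgeSet} (h : (d : Sym2 V) ∉ F) :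
    incidenceVector G F d = 0 := Set.indicator_of_notMem h 1

theorem incidenceVector_empty (G : SimpleGraph V) : incidenceVector G ∅ = 0 :=
  funext fun _ => incidenceVector_of_notMem (Set.notMem_empty _)

theorem incidenceVector_sdiff (G : SimpleGraph V) {X Y : Set (Sym2 V)} (h : Y ⊆ X) :
    incidenceVector G (X \ Y) = incidenceVector G X - incidenceVector G Y :=
  funext fun d => congrFun (Set.indicator_sdiff h (1 : Sym2 V → ℝ)) d

theorem incidenceVector_union (G : SimpleGraph V) {X Y : Set (Sym2 V)} (h : Disjoint X Y) :
    incidenceVector G (X ∪ Y) = incidenceVector G X + incidenceVector G Y :=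
  funext fun d => congrFun (Set.indicator_union_of_disjoint h (1 : Sym2 V → ℝ)) d

theorem isEdgeConnected_two_induce_supp (h : K ≤ G) (hK : ∀ A d, cut K A ≠ {d})
    (Q : K.ConnectedComponent) :
    ((SimpleGraph.toSubgraph K h).induce Q.supp).coe.IsEdgeConnected 2 := by
  set H := (SimpleGraph.toSubgraph K h).induce Q.supp
  have hadj : ∀ {x y}, H.Adj x y ↔ x ∈ Q.supp ∧ y ∈ Q.supp ∧ K.Adj x y := Iff.rfl
  refine (isEdgeConnected_two_iff _).mpr ⟨?_, fun d hd hbr => ?_⟩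
  · have hcoe : H.coe = K.induce Q.supp := by
      ext x y
      exact ⟨fun hxy => hxy.2.2, fun hxy => ⟨x.2, y.2, hxy⟩⟩
    exact hcoe ▸ Q.connected_toSimpleGraph.preconnected
  · obtain ⟨A, hA⟩ := (isBridge_coe_iff_exists_cut hd).mp hbr
    refine hK (A ∩ Q.supp) _ (Eq.trans ?_ hA)
    ext ⟨x, y⟩
    have hsupp : K.Adj x y → (x ∈ Q.supp ↔ y ∈ Q.supp) := Q.mem_supp_congr_adj
    have hle : K.Adj x y → G.Adj x y := @h x y
    simp only [Set.mem_inter_iff, mk_mem_cut, SimpleGraph.Subgraph.mem_edgeSet, hadj]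
    tauto

theorem incidenceVector_edgeSet_mem_span [Finite V] (h : K ≤ G) (hK : ∀ A d, cut K A ≠ {d}) :
    incidenceVector G K.edgeSet ∈ Submodule.span ℝ (subgraphVectors G K) := by
  classical
  have := Fintype.ofFinite K.ConnectedComponent
  set H : K.ConnectedComponent → G.Subgraph := fun Q =>
    (SimpleGraph.toSubgraph K h).induce Q.supp
  have hadj : ∀ {Q x y}, s(x, y) ∈ (H Q).edgeSet ↔ x ∈ Q.supp ∧ y ∈ Q.supp ∧ K.Adj x y := Iff.rfl
  have hsum : incidenceVector G K.edgeSet = ∑ Q, incidenceVector G (H Q).edgeSet := by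
    ext ⟨⟨u, v⟩, huv⟩
    have hmem : ∀ Q, s(u, v) ∈ (H Q).edgeSet ↔
        s(u, v) ∈ K.edgeSet ∧ Q = K.connectedComponentMk u := fun Q => by
      have hsupp : K.Adj u v → (u ∈ Q.supp ↔ v ∈ Q.supp) := Q.mem_supp_congr_adj
      rw [hadj, SimpleGraph.mem_edgeSet, eq_comm, ← SimpleGraph.ConnectedComponent.mem_supp_iff]
      tauto
    rw [Finset.sum_apply]
    simp only [incidenceVector, Set.indicator_apply, hmem, Pi.one_apply, ite_and]
    simp
  rw [hsum]
  refine Submodule.sum_mem _ fun Q _ => Submodule.subset_span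
    ⟨H Q, isEdgeConnected_two_induce_supp h hK Q, ?_, rfl⟩
  rintro ⟨u, v⟩ huv
  exact (hadj.mp huv).2.2

theorem incidenceVector_nonbridges_mem_span [Finite V] (h : K ≤ G) :
    incidenceVector G (nonbridges K) ∈ Submodule.span ℝ (subgraphVectors G K) := by
  set L := K.deleteEdges {c | K.IsBridge c}
  have hL : L.edgeSet = nonbridges K := SimpleGraph.edgeSet_deleteEdges _
  have hLK : L ≤ K := SimpleGraph.deleteEdges_le _
  rw [← hL]
  refine Submodule.span_mono (subgraphVectors_mono G hLK)
    (incidenceVector_edgeSet_mem_span (hLK.trans h) fun A d => ?_)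
  rw [cut_eq_inter_edgeSet hLK, hL]
  exact cut_inter_nonbridges_ne_singleton K A d

theorem incidenceVector_coparClass_mem_span [Finite V] (h : K ≤ G) (hc : c ∈ nonbridges K) :
    incidenceVector G (coparClass K c) ∈ Submodule.span ℝ (subgraphVectors G K) := by
  have hle : K.deleteEdges {c} ≤ K := SimpleGraph.deleteEdges_le _
  have hK := incidenceVector_nonbridges_mem_span h
  have hKc := Submodule.span_mono (subgraphVectors_mono G hle)
    (incidenceVector_nonbridges_mem_span (hle.trans h))
  rw [nonbridges_deleteEdges_singleton, incidenceVector_sdiff G (coparClass_subset_nonbridges hc)]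
    at hKc
  simpa using sub_mem hK hKc

end SubgraphVectors

section ConstantOnClasses

theorem mem_of_forall_indicator_mem {ι R : Type*} [Finite ι] [Semiring R] (r : Setoid ι)
    {M : Submodule R (ι → R)} {x : ι → R} (hx : ∀ {i j}, r i j → x i = x j)
    (hM : ∀ i, x i = 0 ∨ Set.indicator {j | r i j} 1 ∈ M) : x ∈ M := by
  classical
  have := Fintype.ofFinite (Quotient r)
  have hsum : x = ∑ q : Quotient r, x q.out • Set.indicator {j | r q.out j} 1 := by
    ext j
    have hterm : ∀ q : Quotient r, (x q.out • Set.indicator {j | r q.out j} (1 : ι → R)) j =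
        if q = ⟦j⟧ then x j else 0 := by
      intro q
      have hq : r q.out j ↔ q = ⟦j⟧ := by
        rw [← Quotient.eq, Quotient.out_eq]
      by_cases h : r q.out j
      · rw [if_pos (hq.mp h), ← hx h, Pi.smul_apply, Set.indicator_of_mem (by exact h),
          Pi.one_apply, smul_eq_mul, mul_one]
      · simp [h, ← hq]
    simp [Finset.sum_apply, hterm]
  rw [hsum]
  refine Submodule.sum_mem _ fun q _ => ?_
  rcases hM q.out with h | h
  · simp [h]
  · exact M.smul_mem _ h

theorem apply_eq_of_mem_span_subgraphVectors {x : G.edgeSet → ℝ}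
    (hx : x ∈ Submodule.span ℝ (subgraphVectors G K)) {c d : G.edgeSet}
    (hd : (d : Sym2 V) ∈ coparClass G c) : x c = x d := by
  rcases eq_or_ne c d with rfl | hcd
  · rfl
  obtain ⟨A, hA⟩ := (mem_coparClass_iff (Subtype.coe_ne_coe.mpr hcd)).mp hd
  induction hx using Submodule.span_induction with
  | zero => rfl
  | add y z _ _ hy hz => rw [Pi.add_apply, Pi.add_apply, hy, hz]
  | smul t y _ hy => rw [Pi.smul_apply, Pi.smul_apply, hy]
  | mem y hy =>
    obtain ⟨H, hH, -, rfl⟩ := hy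
    have hmem : (c : Sym2 V) ∈ H.edgeSet ↔ (d : Sym2 V) ∈ H.edgeSet := by
      have hc := cut_inter_edgeSet_ne_singleton hH A c
      have hd := cut_inter_edgeSet_ne_singleton hH A d
      rw [hA] at hc hd
      grind
    by_cases hcH : (c : Sym2 V) ∈ H.edgeSet
    · rw [incidenceVector_of_mem hcH, incidenceVector_of_mem (hmem.mp hcH)]
    · rw [incidenceVector_of_notMem hcH, incidenceVector_of_notMem (mt hmem.mpr hcH)]

theorem mem_of_forall_incidenceVector_coparClass_mem [Finite V] {M : Submodule ℝ (G.edgeSet → ℝ)}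
    {x : G.edgeSet → ℝ} (hx : x ∈ Submodule.span ℝ (subgraphVectors G K))
    (hM : ∀ c : G.edgeSet, x c = 0 ∨ incidenceVector G (coparClass G c) ∈ M) : x ∈ M :=
  mem_of_forall_indicator_mem (ι := G.edgeSet)
    { r := fun c d => (d : Sym2 V) ∈ coparClass G c
      iseqv := ⟨fun c => mem_coparClass_self G c, mem_coparClass_symm, mem_coparClass_trans⟩ }
    (apply_eq_of_mem_span_subgraphVectors hx) hM

end ConstantOnClasses

section CutForm

variable [Fintype G.edgeSet] {X : Set (Sym2 V)} {e : G.edgeSet}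

theorem edgeSum_apply (F : Set (Sym2 V)) [DecidablePred fun f : G.edgeSet => (f : Sym2 V) ∈ F]
    (x : G.edgeSet → ℝ) : edgeSum G F x = ∑ f with ((f : G.edgeSet) : Sym2 V) ∈ F, x f := by
  rw [edgeSum, LinearMap.sum_apply]
  exact Finset.sum_congr (by ext; simp) fun _ _ => rfl

theorem edgeSum_incidenceVector (hD : D ⊆ G.edgeSet) (X : Set (Sym2 V)) :
    edgeSum G D (incidenceVector G X) = ((D ∩ X).ncard : ℝ) := by
  classical
  have hcard : (D ∩ X).ncard = (Subtype.val ⁻¹' (D ∩ X) : Set G.edgeSet).ncard := by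
    rw [← Set.ncard_image_of_injective _ Subtype.val_injective, Subtype.image_preimage_val,
      Set.inter_eq_right.mpr (Set.inter_subset_left.trans hD)]
  rw [hcard, Set.ncard_eq_toFinset_card', edgeSum_apply]
  simp only [incidenceVector, Set.indicator_apply, Pi.one_apply, Finset.sum_boole,
    Finset.filter_filter]
  congr 2
  ext f
  simp only [Finset.mem_filter, Finset.mem_univ, true_and, Set.mem_toFinset, Set.mem_preimage,
    Set.mem_inter_iff]

/-- The left-hand side `x_e - x(D \ {e})` of the asymmetric cut inequality of a cut `D`. -/
noncomputable def cutForm (e : G.edgeSet) (D : Set (Sym2 V)) : (G.edgeSet → ℝ) →ₗ[ℝ] ℝ :=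
  LinearMap.proj e - edgeSum G (D \ {(e : Sym2 V)})

theorem cutForm_incidenceVector (hD : D ⊆ G.edgeSet) (e : G.edgeSet) (X : Set (Sym2 V)) :
    cutForm e D (incidenceVector G X) =
      incidenceVector G X e - (((D ∩ X) \ {(e : Sym2 V)}).ncard : ℝ) := by
  rw [cutForm, LinearMap.sub_apply, LinearMap.proj_apply,
    edgeSum_incidenceVector (Set.sdiff_subset.trans hD), Set.sdiff_inter_right_comm]

theorem cutForm_incidenceVector_nonpos (hD : D ⊆ G.edgeSet) (he : (e : Sym2 V) ∈ D)
    (hX : D ∩ X ≠ {(e : Sym2 V)}) : cutForm e D (incidenceVector G X) ≤ 0 := by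
  rw [cutForm_incidenceVector hD, sub_nonpos]
  by_cases heX : (e : Sym2 V) ∈ X
  · have hfin : ((D ∩ X) \ {(e : Sym2 V)}).Finite :=
      (Set.toFinite G.edgeSet).subset fun d hd => hD hd.1.1
    have hpos : 0 < ((D ∩ X) \ {(e : Sym2 V)}).ncard := by
      rw [Set.ncard_pos hfin, Set.sdiff_nonempty]
      exact fun h => hX (h.antisymm (Set.singleton_subset_iff.mpr ⟨he, heX⟩))
    rw [incidenceVector_of_mem heX]
    exact_mod_cast hpos
  · rw [incidenceVector_of_notMem heX]
    exact Nat.cast_nonneg _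

theorem cutForm_incidenceVector_eq_zero_iff (hD : D ⊆ G.edgeSet) (he : (e : Sym2 V) ∈ D)
    (hX : ∀ d, D ∩ X ≠ {d}) :
    cutForm e D (incidenceVector G X) = 0 ↔ ∃ f, D ∩ X ⊆ {(e : Sym2 V), f} := by
  have hfin : ((D ∩ X) \ {(e : Sym2 V)}).Finite :=
    (Set.toFinite G.edgeSet).subset fun d hd => hD hd.1.1
  simp only [← Set.sdiff_singleton_subset_iff]
  have : Nonempty (Sym2 V) := ⟨e⟩
  rw [cutForm_incidenceVector hD, sub_eq_zero, eq_comm,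
    ← Set.ncard_le_one_iff_subset_singleton hfin]
  by_cases heX : (e : Sym2 V) ∈ X
  · have hpos : 0 < ((D ∩ X) \ {(e : Sym2 V)}).ncard := by
      rw [Set.ncard_pos hfin, Set.sdiff_nonempty]
      exact fun h => hX e (h.antisymm (Set.singleton_subset_iff.mpr ⟨he, heX⟩))
    rw [incidenceVector_of_mem heX, Nat.cast_eq_one]
    omega
  · have hne : (D ∩ X).ncard ≠ 1 := fun h => (Set.ncard_eq_one.mp h).elim hX
    rw [incidenceVector_of_notMem heX, Set.sdiff_singleton_eq_self fun h => heX h.2,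
      Nat.cast_eq_zero]
    omega

end CutForm

section TightSpan

variable [Fintype G.edgeSet] {b e : G.edgeSet}

/-- The span of the incidence vectors of those `2`-edge-connected subgraphs that satisfy the
asymmetric cut inequality `x_e - x(D \ {e}) ≤ 0` with equality. -/
def tightSpan (e : G.edgeSet) (D : Set (Sym2 V)) : Submodule ℝ (G.edgeSet → ℝ) :=
  Submodule.span ℝ {x ∈ subgraphVectors G G | cutForm e D x = 0}

theorem tightSpan_le_span_subgraphVectors (e : G.edgeSet) (D : Set (Sym2 V)) :
    tightSpan e D ≤ Submodule.span ℝ (subgraphVectors G G) :=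
  Submodule.span_mono fun _ hx => hx.1

theorem tightSpan_le_ker_cutForm (e : G.edgeSet) (D : Set (Sym2 V)) :
    tightSpan e D ≤ LinearMap.ker (cutForm e D) :=
  Submodule.span_le.mpr fun _ hx => hx.2

theorem cutForm_cut_incidenceVector_eq_zero_iff (he : (e : Sym2 V) ∈ cut G S) {H : G.Subgraph}
    (hH : H.coe.IsEdgeConnected 2) :
    cutForm e (cut G S) (incidenceVector G H.edgeSet) = 0 ↔
      ∃ f, cut G S ∩ H.edgeSet ⊆ {(e : Sym2 V), f} :=
  cutForm_incidenceVector_eq_zero_iff (cut_subset_edgeSet G S) he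
    (cut_inter_edgeSet_ne_singleton hH S)

theorem span_subgraphVectors_le_tightSpan (he : (e : Sym2 V) ∈ cut G S) (f : Sym2 V) :
    Submodule.span ℝ (subgraphVectors G (G.deleteEdges (cut G S \ {(e : Sym2 V), f}))) ≤
      tightSpan e (cut G S) := by
  refine Submodule.span_mono ?_
  rintro _ ⟨H, hH, hHK, rfl⟩
  refine ⟨⟨H, hH, H.edgeSet_subset, rfl⟩,
    (cutForm_cut_incidenceVector_eq_zero_iff he hH).mpr ⟨f, fun d hd => ?_⟩⟩
  have hdK := hHK hd.2
  rw [SimpleGraph.edgeSet_deleteEdges] at hdK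
  exact not_not.mp fun h => hdK.2 ⟨hd.1, h⟩

theorem tightSpan_le_tightSpan (he : (e : Sym2 V) ∈ cut G S) (hb : (b : Sym2 V) ∈ cut G A)
    (h : cut G A ⊆ insert (b : Sym2 V) (cut G S \ {(e : Sym2 V)})) :
    tightSpan e (cut G S) ≤ tightSpan b (cut G A) := by
  refine Submodule.span_mono ?_
  rintro _ ⟨⟨H, hH, hHG, rfl⟩, htight⟩
  obtain ⟨f, hf⟩ := (cutForm_cut_incidenceVector_eq_zero_iff he hH).mp htight
  refine ⟨⟨H, hH, hHG, rfl⟩, (cutForm_cut_incidenceVector_eq_zero_iff hb hH).mpr ⟨f, ?_⟩⟩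
  rintro d ⟨hdA, hdH⟩
  refine (h hdA).imp_right fun hd => ?_
  exact (hf ⟨hd.1, hdH⟩).resolve_left hd.2

theorem bridgesCoparallelTo_of_inf_ker_le_tightSpan [Finite V] (hG : G.IsEdgeConnected 2)
    (he : (e : Sym2 V) ∈ cut G S)
    (hle : Submodule.span ℝ (subgraphVectors G G) ⊓ LinearMap.ker (cutForm e (cut G S)) ≤
      tightSpan e (cut G S)) :
    BridgesCoparallelTo G S (cut G S) := by
  intro u v hadj hbr
  set b : G.edgeSet := ⟨s((u : V), (v : V)), hadj⟩
  by_contra hcon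
  have hclass : cut G S ∩ coparClass G b = ∅ :=
    Set.eq_empty_of_forall_notMem fun g ⟨hgS, hgb⟩ => by
      obtain ⟨C, hC, hbC, hgC⟩ := (exists_isCoparallelClass_iff hG b.2).mpr hgb
      exact hcon ⟨C, hC, hbC, g, hgS, hgC⟩
  obtain ⟨A, hA⟩ := (isBridge_induce_iff_exists_cut hadj).mp hbr
  -- `A` and `S ∆ A` cut out the same edges outside `δ(S)`, and only one of their cuts contains `e`.
  wlog heA : (e : Sym2 V) ∉ cut G A generalizing A
  · refine this (S ∆ A) ?_ ?_ <;> rw [cut_symmDiff]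
    · rw [← hA]
      grind
    · grind
  have hbA : (b : Sym2 V) ∈ cut G A := (hA.ge rfl).1
  have hA_subset : cut G A ⊆ insert (b : Sym2 V) (cut G S \ {(e : Sym2 V)}) := by
    intro d hd
    by_cases hdS : d ∈ cut G S
    · exact Or.inr ⟨hdS, fun hde => heA (hde ▸ hd)⟩
    · exact Or.inl (hA.le ⟨hd, hdS⟩)
  have hA_class : (cut G A ∩ coparClass G b) \ {(b : Sym2 V)} = ∅ := by grind
  have hb : (b : Sym2 V) ∈ nonbridges G := (nonbridges_eq_edgeSet hG).ge b.2
  have hker : cutForm e (cut G S) (incidenceVector G (coparClass G b)) = 0 := by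
    rw [cutForm_incidenceVector (cut_subset_edgeSet G S), hclass,
      incidenceVector_of_notMem fun h => Set.eq_empty_iff_forall_notMem.mp hclass e ⟨he, h⟩]
    simp
  have hzero := tightSpan_le_ker_cutForm b _ (tightSpan_le_tightSpan he hbA hA_subset
    (hle ⟨incidenceVector_coparClass_mem_span le_rfl hb, hker⟩))
  rw [LinearMap.mem_ker, cutForm_incidenceVector (cut_subset_edgeSet G A), hA_class,
    incidenceVector_of_mem (mem_coparClass_self G b)] at hzero
  simp at hzero

theorem exists_mem_tightSpan_eqOn_cut [Finite V] (hS : IsMinimalCut G (cut G S))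
    (he : (e : Sym2 V) ∈ cut G S) {x : G.edgeSet → ℝ} (hx : cutForm e (cut G S) x = 0) :
    ∃ y ∈ tightSpan e (cut G S), ∀ g : G.edgeSet, (g : Sym2 V) ∈ cut G S → x g = y g := by
  classical
  set D := cut G S
  set F : Finset G.edgeSet := {f | (f : Sym2 V) ∈ D \ {(e : Sym2 V)}}
  set y : G.edgeSet → G.edgeSet → ℝ := fun f =>
    incidenceVector G (nonbridges (G.deleteEdges (D \ {(e : Sym2 V), (f : Sym2 V)})))
  have hF : ∀ {f}, f ∈ F ↔ (f : Sym2 V) ∈ D ∧ (f : Sym2 V) ≠ e := by simp [F]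
  have hy : ∀ f ∈ F, ∀ g : G.edgeSet, (g : Sym2 V) ∈ D →
      y f g = if g = e ∨ g = f then 1 else 0 := by
    intro f hf g hg
    obtain ⟨hfD, hfe⟩ := hF.mp hf
    have hmem := Set.ext_iff.mp (hS.inter_nonbridges_deleteEdges he hfD hfe.symm) g
    simp only [Set.mem_inter_iff, hg, true_and, Set.mem_insert_iff, Set.mem_singleton_iff,
      Subtype.coe_inj] at hmem
    simp only [y, incidenceVector, Set.indicator_apply, hmem, Pi.one_apply]
  refine ⟨∑ f ∈ F, x f • y f, Submodule.sum_mem _ fun f _ => Submodule.smul_mem _ _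
    (span_subgraphVectors_le_tightSpan he f
      (incidenceVector_nonbridges_mem_span (SimpleGraph.deleteEdges_le _))), fun g hg => ?_⟩
  simp only [Finset.sum_apply, Pi.smul_apply, smul_eq_mul]
  rw [Finset.sum_congr rfl fun f hf => by rw [hy f hf g hg]]
  rcases eq_or_ne g e with rfl | hge
  · rw [cutForm, LinearMap.sub_apply, LinearMap.proj_apply, edgeSum_apply, sub_eq_zero] at hx
    simpa [F] using hx
  · simp [hge, hF.mpr ⟨hg, Subtype.coe_ne_coe.mpr hge⟩]

theorem incidenceVector_separatedEdges_mem_tightSpan [Finite V] (hG : G.Preconnected)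
    (hS : IsMinimalCut G (cut G S)) {p q : V} (hp : p ∈ S) (he : (e : Sym2 V) = s(p, q))
    (heS : (e : Sym2 V) ∈ cut G S)
    (hc : c ∈ nonbridges (G.deleteEdges (cut G S \ {(e : Sym2 V)}))) (hcS : ∀ x ∈ c, x ∈ S)
    {w z : V} (hw : w ∈ S) (hz : z ∉ S) (hwz : G.Adj w z) (hne : s(w, z) ≠ e) :
    incidenceVector G (separatedEdges (G.deleteEdges (cut G S \ {(e : Sym2 V)})) q c w) ∈
      tightSpan e (cut G S) := by
  set D := cut G S
  set K := G.deleteEdges (D \ {(e : Sym2 V)})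
  set H := G.deleteEdges (D \ {(e : Sym2 V), s(w, z)})
  have hwzD : s(w, z) ∈ D := mk_mem_cut.mpr ⟨hwz, iff_of_true hw hz⟩
  have hHG : H ≤ G := SimpleGraph.deleteEdges_le _
  have hKH : K ≤ H := SimpleGraph.deleteEdges_anti (by grind)
  have hdiff : H.edgeSet \ K.edgeSet = {s(w, z)} := by
    simp only [K, H, SimpleGraph.edgeSet_deleteEdges]
    grind [cut_subset_edgeSet G S]
  have hK : K.Preconnected := hS.preconnected_deleteEdges hG (by grind)
  have hattach : {w' ∈ S | ∃ z' ∉ S, s(w', z') ∈ H.edgeSet \ K.edgeSet} = {w} := by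
    ext w'
    simp only [hdiff, Set.mem_singleton_iff, Sym2.eq_iff, Set.mem_ofPred_eq]
    grind
  have hHS : H.edgeSet \ K.edgeSet ⊆ cut H S := by
    rw [hdiff, cut_deleteEdges, Set.singleton_subset_iff]
    exact ⟨hwzD, fun h => h.2 (Or.inr rfl)⟩
  have hKS : cut K S = {s(p, q)} := by
    rw [cut_deleteEdges, Set.sdiff_sdiff_cancel_left (Set.singleton_subset_iff.mpr heS), he]
  have hsep : coparClass K c \ coparClass H c = separatedEdges K q c w := by
    rw [coparClass_sdiff_coparClass_eq_biUnion hKH hK hc hcS hKS hp hHS, hattach,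
      Set.biUnion_singleton]
  rw [← hsep, incidenceVector_sdiff G (coparClass_anti hKH hc)]
  have hspan := span_subgraphVectors_le_tightSpan heS s(w, z)
  exact sub_mem
    (hspan (Submodule.span_mono (subgraphVectors_mono G hKH)
      (incidenceVector_coparClass_mem_span (hKH.trans hHG) hc)))
    (hspan (incidenceVector_coparClass_mem_span hHG (nonbridges_mono hKH hc)))

theorem incidenceVector_coparClass_mem_tightSpan [Finite V] (hG : G.Preconnected)
    (hS : IsMinimalCut G (cut G S)) (he : (e : Sym2 V) ∈ cut G S)
    (hc : c ∈ nonbridges (G.deleteEdges (cut G S \ {(e : Sym2 V)}))) (hcS : ∀ x ∈ c, x ∈ S) :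
    incidenceVector G (coparClass G c) ∈ tightSpan e (cut G S) := by
  obtain ⟨-, p, hp, q, _, hpq⟩ := id he
  set D := cut G S
  set K := G.deleteEdges (D \ {(e : Sym2 V)})
  have hKG : K ≤ G := SimpleGraph.deleteEdges_le _
  have hK : K.Preconnected :=
    hS.preconnected_deleteEdges hG ⟨Set.sdiff_subset, fun h => (h he).2 rfl⟩
  have hGK : ∀ {d}, d ∈ G.edgeSet \ K.edgeSet ↔ d ∈ D \ {(e : Sym2 V)} := by
    intro d
    simp only [K, SimpleGraph.edgeSet_deleteEdges]
    grind [cut_subset_edgeSet G S]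
  have hKS : cut K S = {s(p, q)} := by
    rw [cut_deleteEdges, Set.sdiff_sdiff_cancel_left (Set.singleton_subset_iff.mpr he), hpq]
  have hclass : incidenceVector G (coparClass K c) ∈ tightSpan e D := by
    refine span_subgraphVectors_le_tightSpan he (e : Sym2 V) ?_
    rw [Set.pair_eq_singleton]
    exact incidenceVector_coparClass_mem_span hKG hc
  have hdiff : incidenceVector G (coparClass K c \ coparClass G c) ∈ tightSpan e D := by
    rw [coparClass_sdiff_coparClass_eq_biUnion hKG hK hc hcS hKS hp fun d hd => (hGK.mp hd).1,
      ← Set.sUnion_image]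
    refine ((isLaminar_range_separatedEdges hK hc q).mono (Set.image_subset_range _ _)
      ).sUnion_induction (P := fun X => incidenceVector G X ∈ tightSpan e D) ?_ ?_
      (Set.toFinite _) ?_
    · simp only [incidenceVector_empty, zero_mem]
    · intro X Y hXY hX hY
      simp only [incidenceVector_union G hXY, add_mem hX hY]
    · rintro _ ⟨w, ⟨hw, z, hz, hwz⟩, rfl⟩
      exact incidenceVector_separatedEdges_mem_tightSpan hG hS hp hpq he hc hcS hw hz hwz.1
        (hGK.mp hwz).2
  rw [incidenceVector_sdiff G (coparClass_anti hKG hc)] at hdiff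
  simpa using sub_mem hclass hdiff

theorem apply_eq_zero_or_incidenceVector_coparClass_mem_tightSpan [Finite V]
    (hG : G.IsEdgeConnected 2) (hS : IsMinimalCut G (cut G S)) (he : (e : Sym2 V) ∈ cut G S)
    (hbr : BridgesCoparallelTo G S (cut G S)) {x : G.edgeSet → ℝ}
    (hx : x ∈ Submodule.span ℝ (subgraphVectors G G))
    (hxS : ∀ g : G.edgeSet, (g : Sym2 V) ∈ cut G S → x g = 0) {c : G.edgeSet}
    (hcS : ∀ v ∈ (c : Sym2 V), v ∈ S) :
    x c = 0 ∨ incidenceVector G (coparClass G c) ∈ tightSpan e (cut G S) := by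
  by_cases hc : (c : Sym2 V) ∈ nonbridges (G.deleteEdges (cut G S \ {(e : Sym2 V)}))
  · exact .inr (incidenceVector_coparClass_mem_tightSpan (hG.preconnected two_ne_zero) hS he hc hcS)
  · obtain ⟨g, hg, hgc⟩ := hbr.exists_mem_cut_mem_coparClass hG e c.2 hcS hc
    refine .inl ((apply_eq_of_mem_span_subgraphVectors hx (d := ⟨g, ?_⟩) hgc).trans (hxS _ hg))
    exact cut_subset_edgeSet G S hg

theorem inf_ker_le_tightSpan_of_bridgesCoparallelTo [Finite V] (hG : G.IsEdgeConnected 2)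
    (hS : IsMinimalCut G (cut G S)) (he : (e : Sym2 V) ∈ cut G S)
    (hbr : BridgesCoparallelTo G S (cut G S)) (hbr' : BridgesCoparallelTo G Sᶜ (cut G S)) :
    Submodule.span ℝ (subgraphVectors G G) ⊓ LinearMap.ker (cutForm e (cut G S)) ≤
      tightSpan e (cut G S) := by
  rintro x ⟨hxW, hxker⟩
  obtain ⟨y, hy, hxy⟩ := exists_mem_tightSpan_eqOn_cut hS he hxker
  suffices hsub : x - y ∈ tightSpan e (cut G S) by simpa using add_mem hsub hy
  have hsubW : x - y ∈ Submodule.span ℝ (subgraphVectors G G) :=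
    sub_mem hxW (tightSpan_le_span_subgraphVectors e _ hy)
  have hzero : ∀ g : G.edgeSet, (g : Sym2 V) ∈ cut G S → (x - y) g = 0 := fun g hg =>
    sub_eq_zero.mpr (hxy g hg)
  refine mem_of_forall_incidenceVector_coparClass_mem hsubW fun ⟨c, hc⟩ => ?_
  by_cases hcD : c ∈ cut G S
  · exact .inl (hzero _ hcD)
  have hsides : (∀ v ∈ c, v ∈ S) ∨ ∀ v ∈ c, v ∈ Sᶜ := by
    induction c with | h u v =>
    rw [mk_mem_cut] at hcD
    have : G.Adj u v := hc
    simp only [Sym2.mem_iff, forall_eq_or_imp, forall_eq, Set.mem_compl_iff]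
    tauto
  rcases hsides with hcS | hcS
  · exact apply_eq_zero_or_incidenceVector_coparClass_mem_tightSpan hG hS he hbr hsubW hzero hcS
  · rw [← cut_compl G S] at hS he hbr' hzero ⊢
    exact apply_eq_zero_or_incidenceVector_coparClass_mem_tightSpan hG hS he hbr' hsubW hzero hcS

theorem cutForm_cut_nonpos (he : (e : Sym2 V) ∈ cut G S) :
    ∀ x ∈ subgraphVectors G G, cutForm e (cut G S) x ≤ 0 := by
  rintro _ ⟨H, hH, -, rfl⟩
  exact cutForm_incidenceVector_nonpos (cut_subset_edgeSet G S) he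
    (cut_inter_edgeSet_ne_singleton hH S e)

theorem cutForm_incidenceVector_edgeSet_ne_zero {D : Set (Sym2 V)} (hD : D ⊆ G.edgeSet)
    (hcard : 3 ≤ D.ncard) (he : (e : Sym2 V) ∈ D) :
    cutForm e D (incidenceVector G G.edgeSet) ≠ 0 := by
  rw [cutForm_incidenceVector hD, incidenceVector_of_mem e.2, Set.inter_eq_left.mpr hD, sub_ne_zero,
    ne_comm, Nat.cast_ne_one, Set.ncard_sdiff_singleton_of_mem he]
  omega

end TightSpan

end TwoEdgeConn

open TwoEdgeConn

theorem mainTheorem5 {V : Type*} [Fintype V] (G : SimpleGraph V) [Fintype G.edgeSet]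
    (hG : G.IsEdgeConnected 2)
    (S : Set V) (hS : S.Nonempty) (hS' : S ≠ Set.univ)
    (hmin : TwoEdgeConn.IsMinimalCut G (TwoEdgeConn.cut G S))
    (hcard : 3 ≤ (TwoEdgeConn.cut G S).ncard)
    (e : G.edgeSet) (he : (e : Sym2 V) ∈ TwoEdgeConn.cut G S) :
    TwoEdgeConn.DefinesFacet (TwoEdgeConn.TECSP G)
        (LinearMap.proj e - TwoEdgeConn.edgeSum G (TwoEdgeConn.cut G S \ {(e : Sym2 V)})) 0 ↔
      TwoEdgeConn.BridgesCoparallelTo G S (TwoEdgeConn.cut G S) ∧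
        TwoEdgeConn.BridgesCoparallelTo G Sᶜ (TwoEdgeConn.cut G S) := by
  have hspan : incidenceVector G G.edgeSet ∈ Submodule.span ℝ (subgraphVectors G G) :=
    incidenceVector_edgeSet_mem_span le_rfl (cut_ne_singleton hG)
  have hnonzero : cutForm e (cut G S) (incidenceVector G G.edgeSet) ≠ 0 :=
    cutForm_incidenceVector_edgeSet_ne_zero (cut_subset_edgeSet G S) hcard he
  have hfacet := definesFacet_convexHull_iff (zero_mem_subgraphVectors G G)
    (cutForm_cut_nonpos he) hspan hnonzero
  rw [← TECSP_eq_convexHull] at hfacet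
  refine hfacet.trans ⟨fun hle => ⟨?_, ?_⟩, fun ⟨hbr, hbr'⟩ => ?_⟩
  · exact bridgesCoparallelTo_of_inf_ker_le_tightSpan hG he hle
  · rw [← cut_compl G S] at he hle ⊢
    exact bridgesCoparallelTo_of_inf_ker_le_tightSpan hG he hle
  · exact inf_ker_le_tightSpan_of_bridgesCoparallelTo hG hmin he hbr hbr'
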